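/- A DRC semigroup is a semigroup $S$ with two unary operations $x\mapsto x^+$, $x\mapsto x^*$ such that for all $x,y\in S$: $x^+x=x$, $(xy)^+=(xy^+)^+$, $(xy)^+=x^+(xy)^+x^+$, $x^{++}=x^+$, $x^{+*}=x^+$, and dually $xx^*=x$, $(xy)^*=(x^*y)^*$, $(xy)^*=y^*(xy)^*y^*$, $x^{**}=x^*$, $x^{*+}=x^*$. It is a DRC-restriction semigroup if moreover $x(yx)^*=(yx^+)^*x$ and $(xy)^+x=x(x^*y)^+$. Its set of projections is $P(S)=\{x^+: x\in S\}=\{x^*:x\in S\}$; with $e\times f=(ef)^+$ and $e\star f=(ef)^*$ it is a strong two-sided projection algebra $(P(S),\times,\star)$. The natural partial order of $S$ is $a\le b\iff a=a^+b$ and $b^+a^+b^+=a^+$. A $(2,1,1)$-homomorphism is a map preserving the product, $^+$ and $^*$. A $(2,1,1)$-congruence is an equivalence relation compatible with these operations; it is projection-separating if distinct projections are never related, and $S$ is fundamental if the identity relation is the only projection-separating $(2,1,1)$-congruence on $S$. Let $$\mu_S=\{(a,b): a^+=b^+,\ a^*=b^*,\ (ap)^+=(bp)^+ \text{ and } (pa)^*=(pb)^*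 \text{ for all } p\in P(S)\}.$$ Here a strong (two-sided) projection algebra is a set $P$ with two binary operations $\times,\star$ satisfying, for all $e,f,g\in P$: $e\times e=e$; $(e\times f)\times e=e\times f$; $e\times(f\times g)=(e\times f)\times(f\times g)$; $(e\times f)\times g=(e\times f)\times(e\times g)$; $e\star e=e$; $f\star e=e\star(f\star e)$; $(g\star f)\star e=(g\star f)\star(f\star e)$; $g\star(f\star e)=(g\star e)\star(f\star e)$; $(e\star(f\times g))\star g=(e\star f)\star g$; $g\times((g\star f)\times e)=g\times(f\times e)$; $(e\times f)\star e=e\times f$; $f\times(e\star f)=e\star f$; $e\times(((e\times f)\times g)\star f)=(e\times f)\times g$; $(f\times(g\star(f\star e)))\star e=g\star(f\star e)$. For a strong projection algebra $(P,\times,\star)$, order $P$ by $e\le f\iff e=f\times e$ (for $P=P(S)$ this is the restriction of the natural partial order of $S$), and put $p^\downarrow=\{x\in P: x\le p\}$, a subalgebra of $P$. Let $M(P)$ be the set of all projection algebra isomorphisms (bijections preserving $\times$ and $\star$) $\alpha:p^\downarrow\to q^\downarrow$, $p,q\in P$. Maps are written on the right and composed from left to right. For $\alpha:p^\downarrow\to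 q^\downarrow$ and $\beta:s^\downarrow\to t^\downarrow$ in $M(P)$ put $\alpha^+=\mathrm{id}_{p^\downarrow}$, $\alpha^*=\mathrm{id}_{q^\downarrow}$ and $$\alpha\bullet\beta=\alpha|_{((q\times s)\alpha^{-1})^\downarrow}\circ\gamma_{q\times s,\,q\star s}\circ\beta|_{(q\star s)^\downarrow},$$ where $\gamma_{q\times s,\,q\star s}:(q\times s)^\downarrow\to(q\star s)^\downarrow$, $x\mapsto x\star(q\star s)$. Write $\mathbf S(M(P))=(M(P),\bullet,{}^+,{}^*)$. Theorem. Let $S$ be a DRC-restriction semigroup. Then $\mathbf S(M(P(S)))$ is a DRC-restriction semigroup, $\mu_S$ is the maximum projection-separating $(2,1,1)$-congruence on $S$, and for every $a\in S$ the map $$\nu_a:(a^+)^\downarrow\to(a^*)^\downarrow,\qquad x\mapsto (xa)^*,$$ is an element of $M(P(S))$. The map $\phi_S:S\to\mathbf S(M(P(S)))$, $a\mapsto\nu_a$, is a $(2,1,1)$-homomorphism with $\ker\phi_S=\mu_S$ and $p\phi_S=\mathrm{id}_{p^\downarrow}$ for all $p\in P(S)$. Consequently $S$ is fundamental if and only if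 $\phi_S$ is injective. Moreover, $\operatorname{im}\phi_S$ is a $(2,1,1)$-subalgebra of $\mathbf S(M(P(S)))$ and a DRC-restriction semigroup, $S/\mu_S$ is a DRC-restriction semigroup, $S/\mu_S\cong\operatorname{im}\phi_S$ via $[a]\mapsto\nu_a$, and both are fundamental. -/

import Mathlib

namespace DRC

universe u v

/-! ## Bi-unary semigroups and DRC-restriction semigroups -/

/-- A set with one binary operation and two unary operations `x ↦ x⁺` (`plus`) and
`x ↦ x*` (`ast`), i.e. an algebra of type (2,1,1); no laws are imposed. -/
class BiUnary (S : Type u) extends Mul S where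
  plus : S → S
  ast : S → S

open BiUnary (plus ast)

/-- The bi-unary algebra `S` is a DRC semigroup. -/
class IsDRC (S : Type u) [BiUnary S] : Prop where
  assoc : ∀ x y z : S, x * y * z = x * (y * z)
  plus_mul : ∀ x : S, plus x * x = x
  mul_ast : ∀ x : S, x * ast x = x
  plus_mul_plus : ∀ x y : S, plus (x * y) = plus (x * plus y)
  ast_ast_mul : ∀ x y : S, ast (x * y) = ast (ast x * y)
  plus_sandwich : ∀ x y : S, plus (x * y) = plus x * plus (x * y) * plus x
  ast_sandwich : ∀ x y : S, ast (x * y) = ast y * ast (x * y) * ast y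
  plus_plus : ∀ x : S, plus (plus x) = plus x
  ast_ast : ∀ x : S, ast (ast x) = ast x
  ast_plus : ∀ x : S, ast (plus x) = plus x
  plus_ast : ∀ x : S, plus (ast x) = ast x

/-- The bi-unary algebra `S` is a DRC-restriction semigroup: a DRC semigroup satisfying the
DRC-ample conditions. -/
class IsDRCRestriction (S : Type u) [BiUnary S] : Prop extends IsDRC S where
  ample_left : ∀ x y : S, x * ast (y * x) = ast (y * plus x) * x
  ample_right : ∀ x y : S, plus (x * y) * x = x * plus (ast x * y)

/-- `e` is a projection, i.e. `e = x⁺` for some `x`. -/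
def IsProj {S : Type u} [BiUnary S] (e : S) : Prop := ∃ x : S, e = plus x

/-- The set `P(S)` of projections, as a type. -/
abbrev Proj (S : Type u) [BiUnary S] : Type u := {e : S // IsProj e}

/-- A (2,1,1)-homomorphism. -/
structure IsHom {S : Type u} {T : Type v} [BiUnary S] [BiUnary T] (φ : S → T) : Prop where
  map_mul : ∀ a b : S, φ (a * b) = φ a * φ b
  map_plus : ∀ a : S, φ (plus a) = plus (φ a)
  map_ast : ∀ a : S, φ (ast a) = ast (φ a)

/-- A (2,1,1)-congruence. -/
structure Congruence (S : Type u) [BiUnary S] extends Setoid S where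
  mul_right : ∀ {a b : S} (c : S), r a b → r (a * c) (b * c)
  mul_left : ∀ {a b : S} (c : S), r a b → r (c * a) (c * b)
  plus_congr : ∀ {a b : S}, r a b → r (plus a) (plus b)
  ast_congr : ∀ {a b : S}, r a b → r (ast a) (ast b)

/-- The congruence `σ` separates projections. -/
def Congruence.ProjectionSeparating {S : Type u} [BiUnary S] (σ : Congruence S) : Prop :=
  ∀ p q : S, IsProj p → IsProj q → σ.r p q → p = q

/-- The quotient algebra `S/σ`. -/
def Congruence.Quot {S : Type u} [BiUnary S] (σ : Congruence S) : Type u :=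
  Quotient σ.toSetoid

/-- The class of `a` in `S/σ`. -/
def Congruence.proj {S : Type u} [BiUnary S] (σ : Congruence S) (a : S) : σ.Quot :=
  Quotient.mk σ.toSetoid a

instance {S : Type u} [BiUnary S] (σ : Congruence S) : BiUnary σ.Quot where
  mul := Quotient.map₂ (fun a b => a * b)
    (fun _ b h c _ h' => σ.iseqv.trans (σ.mul_right c h) (σ.mul_left b h'))
  plus := Quotient.map plus (fun _ _ h => σ.plus_congr h)
  ast := Quotient.map ast (fun _ _ h => σ.ast_congr h)

/-- `S` is projection-fundamental: the only projection-separating (2,1,1)-congruence on `S`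
is the identity relation. -/
def IsFundamental (S : Type u) [BiUnary S] : Prop :=
  ∀ σ : Congruence S, σ.ProjectionSeparating → ∀ a b : S, σ.r a b → a = b

/-- A (2,1,1)-subalgebra. -/
structure Subalg (S : Type u) [BiUnary S] where
  carrier : Set S
  mul_mem : ∀ {a b : S}, a ∈ carrier → b ∈ carrier → a * b ∈ carrier
  plus_mem : ∀ {a : S}, a ∈ carrier → plus a ∈ carrier
  ast_mem : ∀ {a : S}, a ∈ carrier → ast a ∈ carrier

instance {S : Type u} [BiUnary S] (T : Subalg S) : BiUnary T.carrier where
  mul a b := ⟨a.1 * b.1, T.mul_mem a.2 b.2⟩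
  plus a := ⟨plus a.1, T.plus_mem a.2⟩
  ast a := ⟨ast a.1, T.ast_mem a.2⟩

/-- The congruence `μ_S`: `a μ_S b` iff `a⁺ = b⁺`, `a* = b*` and, for every projection `p`,
`(ap)⁺ = (bp)⁺` and `(pa)* = (pb)*`. -/
def mu (S : Type u) [BiUnary S] [IsDRC S] : Congruence S where
  r a b := plus a = plus b ∧ ast a = ast b ∧
    ∀ p : S, IsProj p → plus (a * p) = plus (b * p) ∧ ast (p * a) = ast (p * b)
  iseqv := by
    refine ⟨fun a => ⟨rfl, rfl, fun p _ => ⟨rfl, rfl⟩⟩, ?_, ?_⟩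
    · rintro a b ⟨h1, h2, h3⟩
      exact ⟨h1.symm, h2.symm, fun p hp => ⟨(h3 p hp).1.symm, (h3 p hp).2.symm⟩⟩
    · rintro a b c ⟨h1, h2, h3⟩ ⟨k1, k2, k3⟩
      exact ⟨h1.trans k1, h2.trans k2, fun p hp =>
        ⟨(h3 p hp).1.trans (k3 p hp).1, (h3 p hp).2.trans (k3 p hp).2⟩⟩
  mul_right := by
    rintro a b c ⟨h1, h2, h3⟩
    refine ⟨?_, ?_, fun p hp => ⟨?_, ?_⟩⟩
    · rw [IsDRC.plus_mul_plus a, IsDRC.plus_mul_plus b, (h3 _ ⟨c, rfl⟩).1]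
    · rw [IsDRC.ast_ast_mul a, IsDRC.ast_ast_mul b, h2]
    · rw [IsDRC.assoc, IsDRC.assoc, IsDRC.plus_mul_plus a, IsDRC.plus_mul_plus b,
        (h3 _ ⟨c * p, rfl⟩).1]
    · rw [← IsDRC.assoc, ← IsDRC.assoc, IsDRC.ast_ast_mul (p * a), IsDRC.ast_ast_mul (p * b),
        (h3 p hp).2]
  mul_left := by
    rintro a b c ⟨h1, h2, h3⟩
    refine ⟨?_, ?_, fun p hp => ⟨?_, ?_⟩⟩
    · rw [IsDRC.plus_mul_plus c a, IsDRC.plus_mul_plus c b, h1]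
    · rw [IsDRC.ast_ast_mul c a, IsDRC.ast_ast_mul c b]
      exact (h3 _ ⟨ast c, (IsDRC.plus_ast c).symm⟩).2
    · rw [IsDRC.assoc, IsDRC.assoc, IsDRC.plus_mul_plus c, IsDRC.plus_mul_plus c (b * p),
        (h3 p hp).1]
    · rw [← IsDRC.assoc, ← IsDRC.assoc, IsDRC.ast_ast_mul (p * c), IsDRC.ast_ast_mul (p * c) b]
      exact (h3 _ ⟨ast (p * c), (IsDRC.plus_ast _).symm⟩).2
  plus_congr := by
    rintro a b ⟨h1, _, _⟩
    rw [h1]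
    exact ⟨rfl, rfl, fun _ _ => ⟨rfl, rfl⟩⟩
  ast_congr := by
    rintro a b ⟨_, h2, _⟩
    rw [h2]
    exact ⟨rfl, rfl, fun _ _ => ⟨rfl, rfl⟩⟩

/-! ## Strong projection algebras -/

/-- A strong (two-sided) projection algebra, with operations `e × f` (`tim e f`) and
`e ⋆ f` (`sta e f`). -/
class StrongProjAlg (P : Type u) where
  tim : P → P → P
  sta : P → P → P
  L1 : ∀ e, tim e e = e
  L2 : ∀ e f, tim (tim e f) e = tim e f
  L3 : ∀ e f g, tim e (tim f g) = tim (tim e f) (tim f g)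
  L4 : ∀ e f g, tim (tim e f) g = tim (tim e f) (tim e g)
  R1 : ∀ e, sta e e = e
  R2 : ∀ e f, sta f e = sta e (sta f e)
  R3 : ∀ e f g, sta (sta g f) e = sta (sta g f) (sta f e)
  R4 : ∀ e f g, sta g (sta f e) = sta (sta g e) (sta f e)
  P3a : ∀ e f g, sta (sta e (tim f g)) g = sta (sta e f) g
  P3b : ∀ e f g, tim g (tim (sta g f) e) = tim g (tim f e)
  P4a : ∀ e f, sta (tim e f) e = tim e f
  P4b : ∀ e f, tim f (sta e f) = sta e f
  SP1 : ∀ e f g, tim e (sta (tim (tim e f) g) f) = tim (tim e f) g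
  SP2 : ∀ e f g, sta (tim f (sta g (sta f e))) e = sta g (sta f e)

section ProjOfSemigroup

variable {S : Type u} [BiUnary S]

theorem Proj.plus_eq [IsDRC S] (e : Proj S) : plus e.1 = e.1 := by
  obtain ⟨e, x, rfl⟩ := e
  exact IsDRC.plus_plus x

theorem Proj.ast_eq [IsDRC S] (e : Proj S) : ast e.1 = e.1 := by
  obtain ⟨e, x, rfl⟩ := e
  exact IsDRC.ast_plus x

theorem Proj.mul_self [IsDRC S] (e : Proj S) : e.1 * e.1 = e.1 := by
  have := IsDRC.plus_mul e.1
  rwa [e.plus_eq] at this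

/-- `a⁺` as a projection. -/
def plusP (a : S) : Proj S := ⟨plus a, a, rfl⟩

/-- `a*` as a projection. -/
def astP [IsDRC S] (a : S) : Proj S := ⟨ast a, ast a, (IsDRC.plus_ast a).symm⟩

theorem Proj.mul_plus [IsDRC S] (e : Proj S) (x : S) : e.1 * plus (e.1 * x) = plus (e.1 * x) := by
  have h := IsDRC.plus_sandwich e.1 x
  rw [e.plus_eq] at h
  rw [h, ← IsDRC.assoc, ← IsDRC.assoc, e.mul_self]

theorem Proj.plus_mul_self [IsDRC S] (e : Proj S) (x : S) :
    plus (e.1 * x) * e.1 = plus (e.1 * x) := by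
  have h := IsDRC.plus_sandwich e.1 x
  rw [e.plus_eq] at h
  rw [h, IsDRC.assoc, e.mul_self]

theorem Proj.ast_mul [IsDRC S] (e : Proj S) (x : S) : ast (x * e.1) * e.1 = ast (x * e.1) := by
  have h := IsDRC.ast_sandwich x e.1
  rw [e.ast_eq] at h
  rw [h, IsDRC.assoc, e.mul_self]

theorem Proj.mul_ast_self [IsDRC S] (e : Proj S) (x : S) :
    e.1 * ast (x * e.1) = ast (x * e.1) := by
  have h := IsDRC.ast_sandwich x e.1
  rw [e.ast_eq] at h
  rw [h, ← IsDRC.assoc, ← IsDRC.assoc, e.mul_self]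

theorem Proj.plus_mul_right [IsDRC S] (e : Proj S) (x : S) : plus (e.1 * x) * x = e.1 * x := by
  conv_lhs => rw [← e.plus_mul_self x, IsDRC.assoc, IsDRC.plus_mul]

theorem Proj.mul_ast_left [IsDRC S] (e : Proj S) (x : S) : x * ast (x * e.1) = x * e.1 := by
  conv_lhs => rw [← e.mul_ast_self x, ← IsDRC.assoc, IsDRC.mul_ast]

/-- The strong projection algebra `(P(S), ×, ⋆)` of a DRC-restriction semigroup:
`e × f = (ef)⁺` and `e ⋆ f = (ef)*`. -/
instance instStrongProjAlg [IsDRCRestriction S] : StrongProjAlg (Proj S) where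
  tim e f := plusP (e.1 * f.1)
  sta e f := astP (e.1 * f.1)
  L1 e := Subtype.ext (by simp only [plusP]; rw [e.mul_self, e.plus_eq])
  L2 e f := Subtype.ext (by
    simp only [plusP]; rw [e.plus_mul_self, IsDRC.plus_plus])
  L3 e f g := Subtype.ext (by
    simp only [plusP]
    rw [← IsDRC.plus_mul_plus, ← IsDRC.plus_mul_plus, ← IsDRC.assoc (plus (e.1 * f.1)),
      e.plus_mul_right, IsDRC.assoc])
  L4 e f g := Subtype.ext (by
    simp only [plusP]
    rw [← IsDRC.plus_mul_plus (plus (e.1 * f.1)) (e.1 * g.1), ← IsDRC.assoc (plus (e.1 * f.1)),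
      e.plus_mul_self])
  R1 e := Subtype.ext (by simp only [astP]; rw [e.mul_self, e.ast_eq])
  R2 e f := Subtype.ext (by
    simp only [astP]; rw [e.mul_ast_self, IsDRC.ast_ast])
  R3 e f g := Subtype.ext (by
    simp only [astP]
    rw [← IsDRC.ast_ast_mul, ← IsDRC.ast_ast_mul, IsDRC.assoc, IsDRC.assoc g.1,
      e.mul_ast_left])
  R4 e f g := Subtype.ext (by
    simp only [astP]
    rw [← IsDRC.ast_ast_mul (g.1 * e.1), IsDRC.assoc g.1, e.mul_ast_self])
  P3a e f g := Subtype.ext (by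
    simp only [astP, plusP]
    rw [← IsDRC.ast_ast_mul, ← IsDRC.ast_ast_mul, IsDRC.assoc, f.plus_mul_right, IsDRC.assoc])
  P3b e f g := Subtype.ext (by
    simp only [astP, plusP]
    rw [← IsDRC.plus_mul_plus, ← IsDRC.plus_mul_plus, ← IsDRC.assoc, f.mul_ast_left,
      IsDRC.assoc])
  P4a e f := Subtype.ext (by
    simp only [astP, plusP]
    rw [e.plus_mul_self, IsDRC.ast_plus])
  P4b e f := Subtype.ext (by
    simp only [astP, plusP]
    rw [f.mul_ast_self, IsDRC.plus_ast])
  SP1 e f g := Subtype.ext (by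
    simp only [astP, plusP]
    have k1 : plus (plus (e.1 * f.1) * g.1) * plus (e.1 * f.1) = plus (plus (e.1 * f.1) * g.1) :=
      (plusP (e.1 * f.1)).plus_mul_self g.1
    generalize hh : plus (plus (e.1 * f.1) * g.1) = h at k1 ⊢
    have k0 : plus h = h := by rw [← hh, IsDRC.plus_plus]
    have k0' : ast h = h := by rw [← hh, IsDRC.ast_plus]
    have k2 : h * (e.1 * f.1) = h * f.1 := by
      rw [← IsDRC.assoc]
      congr 1
      rw [← k1, IsDRC.assoc, e.plus_mul_self]
    have k3 := IsDRCRestriction.ample_left (e.1 * f.1) h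
    rw [k1, k0', k2, IsDRC.assoc, f.mul_ast_self] at k3
    rw [k3, ← k2, IsDRC.plus_mul_plus, k1, k0])
  SP2 e f g := Subtype.ext (by
    simp only [astP, plusP]
    have k1 : ast (f.1 * e.1) * ast (g.1 * ast (f.1 * e.1)) = ast (g.1 * ast (f.1 * e.1)) :=
      (astP (f.1 * e.1)).mul_ast_self g.1
    generalize hh : ast (g.1 * ast (f.1 * e.1)) = h at k1 ⊢
    have k0 : plus h = h := by rw [← hh, IsDRC.plus_ast]
    have k0' : ast h = h := by rw [← hh, IsDRC.ast_ast]
    have k2 : f.1 * e.1 * h = f.1 * h := by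
      rw [IsDRC.assoc]
      congr 1
      rw [← k1, ← IsDRC.assoc, e.mul_ast_self]
    have k3 := IsDRCRestriction.ample_right (f.1 * e.1) h
    rw [k1, k0, k2, ← IsDRC.assoc, f.plus_mul_self] at k3
    rw [k3, ← k2, IsDRC.ast_ast_mul, k1, k0'])

end ProjOfSemigroup

section StrongProjAlg

open StrongProjAlg (tim sta)

variable {P : Type u} [StrongProjAlg P]

/-- The natural partial order of a projection algebra: `e ≤ f` iff `e = f × e`. -/
def PLe (e f : P) : Prop := e = tim f e

/-- The principal down-set `p↓`. -/
def down (p : P) : Set P := {x | PLe x p}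

theorem PLe.tim_right {e f : P} (h : PLe e f) : tim e f = e := by
  unfold PLe at h
  rw [h, StrongProjAlg.L2]

theorem PLe.sta_right {e f : P} (h : PLe e f) : sta e f = e := by
  unfold PLe at h
  rw [h, StrongProjAlg.P4a]

theorem PLe.sta_left {e f : P} (h : PLe e f) : sta f e = e := by
  have := StrongProjAlg.R2 f e
  rw [h.sta_right] at this
  exact this.symm

theorem PLe.rfl' (e : P) : PLe e e := (StrongProjAlg.L1 e).symm

theorem PLe.trans {e f g : P} (h : PLe e f) (k : PLe f g) : PLe e g := by
  unfold PLe at *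
  have := StrongProjAlg.L3 g f e
  rw [← k, ← h, ← h] at this
  exact this.symm

theorem tim_le (e f : P) : PLe (tim e f) e := by
  have := StrongProjAlg.L4 e e f
  rw [StrongProjAlg.L1] at this
  exact this

theorem sta_le (e f : P) : PLe (sta e f) f := (StrongProjAlg.P4b e f).symm

theorem self_mem_down (p : P) : p ∈ down p := PLe.rfl' p

theorem tim_mem_down {p x : P} (hx : x ∈ down p) (y : P) : tim x y ∈ down p :=
  (tim_le x y).trans hx

theorem sta_mem_down {p y : P} (x : P) (hy : y ∈ down p) : sta x y ∈ down p :=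
  (sta_le x y).trans hy

/-- The inclusion `p↓ ⊆ q↓` for `p ≤ q`. -/
def inclD {p q : P} (h : p ∈ down q) (x : down p) : down q := ⟨x.1, PLe.trans x.2 h⟩

/-- The operation `×` of the subalgebra `p↓`. -/
def timD {p : P} (x y : down p) : down p := ⟨tim x.1 y.1, tim_mem_down x.2 y.1⟩

/-- The operation `⋆` of the subalgebra `p↓`. -/
def staD {p : P} (x y : down p) : down p := ⟨sta x.1 y.1, sta_mem_down x.1 y.2⟩

variable (P) in
/-- `M(P)`: an element is a projection algebra isomorphism from a principal down-set `p↓`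
(`p = src`) onto a principal down-set `q↓` (`q = tgt`). -/
structure MP where
  src : P
  tgt : P
  iso : down src ≃ down tgt
  map_tim : ∀ x y, iso (timD x y) = timD (iso x) (iso y)
  map_sta : ∀ x y, iso (staD x y) = staD (iso x) (iso y)

namespace MP

/-- `id` on `p↓`. -/
def idD (p : P) : MP P where
  src := p
  tgt := p
  iso := Equiv.refl _
  map_tim _ _ := rfl
  map_sta _ _ := rfl

/-- The composite `αβ` (first `α`, then `β`) when the range of `α` is the domain of `β`. -/
def comp (α β : MP P) (h : α.tgt = β.src) : MP P where
  src := α.src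
  tgt := β.tgt
  iso := (α.iso.trans (Equiv.setCongr (congrArg down h))).trans β.iso
  map_tim x y := by
    have : ∀ u v : down α.tgt, Equiv.setCongr (congrArg down h) (timD u v) =
        timD (Equiv.setCongr (congrArg down h) u) (Equiv.setCongr (congrArg down h) v) :=
      fun _ _ => rfl
    simp only [Equiv.trans_apply, α.map_tim, this, β.map_tim]
  map_sta x y := by
    have : ∀ u v : down α.tgt, Equiv.setCongr (congrArg down h) (staD u v) =
        staD (Equiv.setCongr (congrArg down h) u) (Equiv.setCongr (congrArg down h) v) :=
      fun _ _ => rfl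
    simp only [Equiv.trans_apply, α.map_sta, this, β.map_sta]

theorem iso_le_iff (α : MP P) (x y : down α.src) :
    PLe (α.iso x).1 (α.iso y).1 ↔ PLe x.1 y.1 := by
  have h1 : PLe (α.iso x).1 (α.iso y).1 ↔ α.iso x = α.iso (timD y x) := by
    rw [α.map_tim, Subtype.ext_iff]; rfl
  rw [h1, α.iso.injective.eq_iff, Subtype.ext_iff]; rfl

/-- The restriction `α|_{p↓}` for `p` in the domain of `α`; its range is `(pα)↓`. -/
def restr (α : MP P) (p : down α.src) : MP P where
  src := p.1
  tgt := (α.iso p).1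
  iso :=
    { toFun := fun x => ⟨(α.iso (inclD p.2 x)).1, (α.iso_le_iff (inclD p.2 x) p).2 x.2⟩
      invFun := fun y =>
        ⟨(α.iso.symm (inclD (α.iso p).2 y)).1, by
          have := (α.iso_le_iff (α.iso.symm (inclD (α.iso p).2 y)) p).1
          rw [Equiv.apply_symm_apply] at this
          exact this y.2⟩
      left_inv := fun x => by
        apply Subtype.ext
        change (α.iso.symm (α.iso (inclD p.2 x))).1 = x.1
        rw [Equiv.symm_apply_apply]
        rfl
      right_inv := fun y => by
        apply Subtype.ext
        change (α.iso (α.iso.symm (inclD (α.iso p).2 y))).1 = y.1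
        rw [Equiv.apply_symm_apply]
        rfl }
  map_tim x y := by
    apply Subtype.ext
    have h := congrArg Subtype.val (α.map_tim (inclD p.2 x) (inclD p.2 y))
    exact h
  map_sta x y := by
    apply Subtype.ext
    have h := congrArg Subtype.val (α.map_sta (inclD p.2 x) (inclD p.2 y))
    exact h

end MP

/-- The relation `p 𝓕 q`: `p × q = p` and `p ⋆ q = q`. -/
def FRel (p q : P) : Prop := tim p q = p ∧ sta p q = q

theorem tim_sta_self (e f : P) : tim e (sta e f) = tim e f := by
  have := StrongProjAlg.P3b f f e
  rw [StrongProjAlg.L1, PLe.tim_right (sta_le e f)] at this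
  exact this

theorem sta_tim_self (e f : P) : sta (tim e f) f = sta e f := by
  have := StrongProjAlg.P3a e e f
  rw [StrongProjAlg.R1, PLe.sta_left (tim_le e f)] at this
  exact this

theorem fRel_tim_sta (e f : P) : FRel (tim e f) (sta e f) := by
  constructor
  · rw [StrongProjAlg.L4, tim_sta_self, StrongProjAlg.L1]
  · rw [StrongProjAlg.R4 f e (tim e f), sta_tim_self, StrongProjAlg.R1]

theorem FRel.left_inv {p q x : P} (h : FRel p q) (hx : PLe x p) : tim p (sta x q) = x := by
  have := StrongProjAlg.SP1 p q x
  rw [h.1, ← hx] at this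
  exact this

theorem FRel.right_inv {p q y : P} (h : FRel p q) (hy : PLe y q) : sta (tim p y) q = y := by
  have := StrongProjAlg.SP2 q p y
  rw [h.2, hy.sta_right] at this
  exact this

theorem sta_tim_eq (x s p : P) : sta x (tim s p) = tim s (sta (sta x s) p) := by
  have h := StrongProjAlg.SP1 s p (sta x (tim s p))
  rw [← sta_le x (tim s p), StrongProjAlg.P3a] at h
  exact h.symm

theorem tim_sta_eq (x s p : P) : tim (sta p s) x = sta (tim p (tim s x)) s := by
  have h := StrongProjAlg.SP2 s p (tim (sta p s) x)
  rw [PLe.sta_right (tim_le (sta p s) x), StrongProjAlg.P3b] at h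
  exact h.symm

/-- `γ_{p,q} : p↓ → q↓`, `x ↦ x ⋆ q`, for `p 𝓕 q`; its inverse is `y ↦ p × y`. -/
def gam (p q : P) (h : FRel p q) : MP P where
  src := p
  tgt := q
  iso :=
    { toFun := fun x => ⟨sta x.1 q, sta_le x.1 q⟩
      invFun := fun y => ⟨tim p y.1, tim_le p y.1⟩
      left_inv := fun x => Subtype.ext (h.left_inv x.2)
      right_inv := fun y => Subtype.ext (h.right_inv y.2) }
  map_tim := by
    rintro ⟨x, hx⟩ ⟨y, hy⟩
    apply Subtype.ext
    change sta (tim x y) q = tim (sta x q) (sta y q)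
    have hY : PLe (sta y q) q := sta_le y q
    have e1 := StrongProjAlg.L4 p x (sta y q)
    rw [← show x = tim p x from hx, h.left_inv hy] at e1
    rw [tim_sta_eq (sta y q) q x, ← hY, e1]
  map_sta := by
    rintro ⟨x, hx⟩ ⟨y, hy⟩
    apply Subtype.ext
    change sta (sta x y) q = sta (sta x q) (sta y q)
    have hY : PLe (sta y q) q := sta_le y q
    have e1 := sta_tim_eq x p (sta y q)
    rw [h.left_inv hy, PLe.sta_right hx] at e1
    rw [e1, h.right_inv ((sta_le x (sta y q)).trans hY), ← StrongProjAlg.R4]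

namespace MP

/-- The right restriction of `α` to the principal down-set `f↓` of its range, that is,
`α|_{(fα⁻¹)↓}`; its range is `f↓`. -/
def restrR (α : MP P) (f : down α.tgt) : MP P := α.restr (α.iso.symm f)

theorem restrR_tgt (α : MP P) (f : down α.tgt) : (α.restrR f).tgt = f.1 := by
  simp [restrR, restr]

/-- The product of `α : p↓ → q↓` and `β : s↓ → t↓` in `S(M(P))`:
`α|_{((q × s)α⁻¹)↓} ∘ γ_{q × s, q ⋆ s} ∘ β|_{(q ⋆ s)↓}`, maps being composed from left to right. -/
def bul (α β : MP P) : MP P :=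
  comp
    (comp (α.restrR ⟨tim α.tgt β.src, tim_le α.tgt β.src⟩)
      (gam (tim α.tgt β.src) (sta α.tgt β.src) (fRel_tim_sta α.tgt β.src))
      (restrR_tgt α _))
    (β.restr ⟨sta α.tgt β.src, sta_le α.tgt β.src⟩) rfl

/-- `S(M(P)) = (M(P), •, ⁺, *)`, where `α⁺` and `α*` are the identity maps on the domain and on
the range of `α`. -/
instance : BiUnary (MP P) where
  mul α β := bul α β
  plus α := idD α.src
  ast α := idD α.tgt

end MP

end StrongProjAlg

section NaturalOrder

variable {S : Type u} [BiUnary S]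

/-- The natural partial order of a DRC-restriction semigroup: `a ≤ b` iff `a = a⁺b` and
`b⁺a⁺b⁺ = a⁺`. -/
def NatLe (a b : S) : Prop := a = plus a * b ∧ plus b * plus a * plus b = plus a

/-- On projections, the natural partial order of `S` is the order of the projection algebra. -/
theorem natLe_iff [IsDRCRestriction S] (e f : Proj S) : NatLe e.1 f.1 ↔ PLe e f := by
  have h0 : PLe e f ↔ e.1 = plus (f.1 * e.1) := Subtype.ext_iff
  rw [h0]
  unfold NatLe
  rw [e.plus_eq, f.plus_eq]
  constructor
  · rintro ⟨h1, h2⟩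
    have : f.1 * e.1 = e.1 := by
      rw [← h2, ← IsDRC.assoc, ← IsDRC.assoc, f.mul_self]
    rw [this, e.plus_eq]
  · intro h
    have k1 : f.1 * e.1 = e.1 := by rw [h, f.mul_plus]
    have k2 : e.1 * f.1 = e.1 := by
      have := f.plus_mul_self e.1
      rwa [← h] at this
    exact ⟨k2.symm, by rw [k1, k2]⟩

end NaturalOrder

end DRC

namespace DRC

open BiUnary (plus ast)

/-! ### Absorption laws in a strong projection algebra, and the algebra of isomorphisms between its
down-sets. -/

section StrongProjAlg

open StrongProjAlg (tim sta)

variable {P : Type*} [StrongProjAlg P]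

/-! The product in `M(P)` is awkward because its factors are partial maps glued by `gam`. Each α :
p↓ → q↓ therefore gets two total maps on `P`: `fwd`, applying α after `· ⋆ p`, and `bwd`, applying
α⁻¹ after `q × ·`. The glue then disappears: `fwd_mul` and `bwd_mul` say that products become plain
composites, and the source and target of αβ are values of `bwd` and `fwd`. By `ext_of_fwd`, an
equation in `M(P)` reduces to source, target and `fwd`; associativity becomes that of composition,
and the other axioms are short computations in `P`.

For ν_a these total maps are x ↦ (xa)* and y ↦ (ay)⁺ on all projections (`fwd_nu`, `bwd_nu`). So
multiplicativity is a DRC identity, and the kernel is μ_S because the data defining μ_S are exactly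
the source, target and total maps of ν_a. That ν_a is an isomorphism rests on the ample conditions,
which move a projection e ≤ a⁺ across a: ea = a(ea)*.

A projection-separating congruence lies inside μ_S, since related elements have equal ⁺ and * after
any multiplication. If a surjective homomorphism has kernel μ_S, such a congruence on its image
pulls back to one on the domain, hence lies in the kernel; so the image is fundamental. -/

theorem PLe.tim_left {e f : P} (h : PLe e f) : tim f e = e := Eq.symm h

/-- This is `sta_tim_eq` with both outer applications of `p × ·` acting trivially below `p`. It and
the next three laws remove redundant projections when total maps are composed. -/
theorem sta_sta_of_le {p u : P} (x : P) (h : PLe u p) : sta (sta x p) u = sta x u := by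
  have h1 := sta_tim_eq x p u
  rw [h.tim_left, ((sta_le (sta x p) u).trans h).tim_left] at h1
  exact h1.symm

theorem tim_tim_of_le {p u : P} (x : P) (h : PLe u p) : tim u (tim p x) = tim u x := by
  have h1 := tim_sta_eq x p u
  rw [h.sta_right, ((tim_le u (tim p x)).trans h).sta_right] at h1
  exact h1.symm

theorem sta_sta_of_le_left {q z : P} (s : P) (h : PLe z q) : sta z (sta q s) = sta z s := by
  have h1 := StrongProjAlg.R3 s q z
  rw [h.sta_right] at h1
  exact h1.symm

theorem tim_tim_of_le_right {s z : P} (q : P) (h : PLe z s) : tim (tim q s) z = tim q z := by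
  have h1 := StrongProjAlg.L3 q s z
  rw [h.tim_left] at h1
  exact h1.symm

/-! ### Total extensions of partial isomorphisms, and their composition. -/

namespace MP

/-- An order isomorphism between down-sets must send the top element to the top element. -/
theorem iso_top (α : MP P) : (α.iso ⟨α.src, self_mem_down α.src⟩).1 = α.tgt := by
  have h := (α.iso_le_iff (α.iso.symm ⟨α.tgt, self_mem_down _⟩) ⟨α.src, self_mem_down _⟩).2
    (α.iso.symm ⟨α.tgt, self_mem_down _⟩).2
  rw [Equiv.apply_symm_apply] at h
  have h2 : PLe (α.iso ⟨α.src, self_mem_down α.src⟩).1 α.tgt := (α.iso _).2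
  exact h2.tim_left.symm.trans h.tim_right

theorem iso_symm_top (α : MP P) : (α.iso.symm ⟨α.tgt, self_mem_down α.tgt⟩).1 = α.src := by
  have h : α.iso ⟨α.src, self_mem_down α.src⟩ = ⟨α.tgt, self_mem_down α.tgt⟩ :=
    Subtype.ext α.iso_top
  rw [← h, Equiv.symm_apply_apply]

theorem symm_tim (α : MP P) (x y : down α.tgt) :
    α.iso.symm (timD x y) = timD (α.iso.symm x) (α.iso.symm y) := by
  rw [Equiv.symm_apply_eq, α.map_tim, Equiv.apply_symm_apply, Equiv.apply_symm_apply]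

/-- The extension `x ↦ (x ⋆ p)α` of `α : p↓ → q↓` to all of `P`. -/
def fwd (α : MP P) (x : P) : P := (α.iso ⟨sta x α.src, sta_le x α.src⟩).1

/-- The extension `y ↦ (q × y)α⁻¹` of the inverse of `α : p↓ → q↓` to all of `P`. -/
def bwd (α : MP P) (y : P) : P := (α.iso.symm ⟨tim α.tgt y, tim_le α.tgt y⟩).1

theorem fwd_le (α : MP P) (x : P) : PLe (α.fwd x) α.tgt := (α.iso _).2

theorem bwd_le (α : MP P) (y : P) : PLe (α.bwd y) α.src := (α.iso.symm _).2

theorem fwd_coe (α : MP P) (x : down α.src) : α.fwd x.1 = (α.iso x).1 := by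
  have h : (⟨sta x.1 α.src, sta_le x.1 α.src⟩ : down α.src) = x :=
    Subtype.ext (PLe.sta_right x.2)
  rw [fwd, h]

theorem bwd_coe (α : MP P) (y : down α.tgt) : α.bwd y.1 = (α.iso.symm y).1 := by
  have h : (⟨tim α.tgt y.1, tim_le α.tgt y.1⟩ : down α.tgt) = y :=
    Subtype.ext (PLe.tim_left y.2)
  rw [bwd, h]

theorem fwd_sta_src (α : MP P) (x : P) : α.fwd (sta x α.src) = α.fwd x :=
  α.fwd_coe ⟨sta x α.src, sta_le x α.src⟩

theorem bwd_tim_tgt (α : MP P) (y : P) : α.bwd (tim α.tgt y) = α.bwd y :=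
  α.bwd_coe ⟨tim α.tgt y, tim_le α.tgt y⟩

theorem fwd_src (α : MP P) : α.fwd α.src = α.tgt :=
  (α.fwd_coe ⟨α.src, self_mem_down α.src⟩).trans α.iso_top

theorem bwd_tgt (α : MP P) : α.bwd α.tgt = α.src :=
  (α.bwd_coe ⟨α.tgt, self_mem_down α.tgt⟩).trans α.iso_symm_top

theorem bwd_fwd (α : MP P) (x : P) : α.bwd (α.fwd x) = sta x α.src := by
  unfold fwd
  rw [bwd_coe, Equiv.symm_apply_apply]

theorem fwd_bwd (α : MP P) (y : P) : α.fwd (α.bwd y) = tim α.tgt y := by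
  unfold bwd
  rw [fwd_coe, Equiv.apply_symm_apply]

/-- Only `u` has to lie below the source: `x` may be cut down to `x ⋆ p` first, and `sta_sta_of_le`
makes that cut invisible under `· ⋆ u`. -/
theorem fwd_sta_of_le (α : MP P) (x : P) {u : P} (h : PLe u α.src) :
    α.fwd (sta x u) = sta (α.fwd x) (α.fwd u) := by
  have h1 := congrArg Subtype.val (α.map_sta ⟨sta x α.src, sta_le x α.src⟩ ⟨u, h⟩)
  rw [← fwd_coe] at h1
  change α.fwd (sta (sta x α.src) u) = sta (α.fwd x) (α.iso ⟨u, h⟩).1 at h1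
  rw [← fwd_coe, sta_sta_of_le x h] at h1
  exact h1

theorem bwd_tim_of_le (α : MP P) (y : P) {v : P} (h : PLe v α.tgt) :
    α.bwd (tim v y) = tim (α.bwd v) (α.bwd y) := by
  have h1 := congrArg Subtype.val (α.symm_tim ⟨v, h⟩ ⟨tim α.tgt y, tim_le α.tgt y⟩)
  rw [← bwd_coe] at h1
  change α.bwd (tim v (tim α.tgt y)) = tim (α.iso.symm ⟨v, h⟩).1 (α.bwd y) at h1
  rw [← bwd_coe, tim_tim_of_le y h] at h1
  exact h1

/-- On the source down-set `fwd` agrees with the isomorphism itself, so nothing is lost in the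
passage to total maps. -/
theorem ext_of_fwd {α β : MP P} (h1 : α.src = β.src) (h2 : α.tgt = β.tgt)
    (h3 : ∀ x, α.fwd x = β.fwd x) : α = β := by
  have h3' : ∀ (x : P) (hx : x ∈ down α.src) (hx' : x ∈ down β.src),
      (α.iso ⟨x, hx⟩).1 = (β.iso ⟨x, hx'⟩).1 := fun x hx hx' => by
    rw [← fwd_coe, ← fwd_coe]; exact h3 x
  obtain ⟨p, q, i, _, _⟩ := α
  obtain ⟨p', q', j, _, _⟩ := β
  obtain rfl : p = p' := h1
  obtain rfl : q = q' := h2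
  obtain rfl : i = j := Equiv.ext fun x => Subtype.ext (h3' x.1 x.2 x.2)
  rfl

theorem src_plus (α : MP P) : (plus α).src = α.src := rfl

theorem tgt_plus (α : MP P) : (plus α).tgt = α.src := rfl

theorem src_ast (α : MP P) : (ast α).src = α.tgt := rfl

theorem tgt_ast (α : MP P) : (ast α).tgt = α.tgt := rfl

theorem fwd_plus (α : MP P) (x : P) : (plus α).fwd x = sta x α.src := rfl

theorem fwd_ast (α : MP P) (x : P) : (ast α).fwd x = sta x α.tgt := rfl

theorem bwd_plus (α : MP P) (y : P) : (plus α).bwd y = tim α.src y := rfl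

theorem bwd_ast (α : MP P) (y : P) : (ast α).bwd y = tim α.tgt y := rfl

theorem src_mul (α β : MP P) : (α * β).src = α.bwd β.src := rfl

theorem tgt_mul (α β : MP P) : (α * β).tgt = β.fwd α.tgt := rfl

/-- The connecting map `z ↦ z ⋆ (q ⋆ s)` agrees with `z ↦ z ⋆ s` below `q`, and `β.fwd` already
begins with `· ⋆ s`, so `gam` is absorbed. -/
theorem mul_iso_coe (α β : MP P) (x : down (α * β).src) :
    ((α * β).iso x).1 = β.fwd (α.fwd x.1) := by
  have hx : PLe x.1 α.src := PLe.trans x.2 (α.bwd_le β.src)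
  have hy : PLe (α.fwd x.1) (tim α.tgt β.src) := by
    have h := (α.iso_le_iff ⟨x.1, hx⟩ ⟨_, α.bwd_le β.src⟩).2 x.2
    rw [← fwd_coe, ← fwd_coe, fwd_bwd] at h
    exact h
  have h2 : ((α * β).iso x).1 = β.fwd (sta (α.iso ⟨x.1, hx⟩).1 (sta α.tgt β.src)) :=
    (β.fwd_coe _).symm
  rw [h2, ← fwd_coe, sta_sta_of_le_left _ (hy.trans (tim_le _ _)), fwd_sta_src]

theorem fwd_mul (α β : MP P) (x : P) : (α * β).fwd x = β.fwd (α.fwd x) := by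
  change ((α * β).iso ⟨sta x (α * β).src, _⟩).1 = _
  rw [mul_iso_coe]
  change β.fwd (α.fwd (sta x (α * β).src)) = _
  -- Exposing the hidden `· ⋆ s` of `β.fwd` lets `P3a` replace `⋆ (q × s)` by `⋆ q`, which is
  -- trivial on the range of α.
  rw [src_mul, fwd_sta_of_le _ _ (α.bwd_le _), fwd_bwd, ← fwd_sta_src, StrongProjAlg.P3a,
    (α.fwd_le x).sta_right, fwd_sta_src]

/-- The inverse of the product is not unfolded. Instead, a preimage of `y`, cut down to the target
of `α * β`, is exhibited and `fwd_mul` is inverted. -/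
theorem bwd_mul (α β : MP P) (y : P) : (α * β).bwd y = α.bwd (β.bwd y) := by
  -- The candidate preimage lies in the domain of the product; α reflects the order, so this is
  -- checked below `α.tgt`.
  have hw : PLe (α.bwd (tim α.tgt (β.bwd (tim (α * β).tgt y)))) (α * β).src := by
    rw [src_mul, ← bwd_tim_tgt α β.src]
    have h := (α.iso_le_iff
      ⟨_, α.bwd_le (tim α.tgt (β.bwd (tim (α * β).tgt y)))⟩
      ⟨_, α.bwd_le (tim α.tgt β.src)⟩).1
    rw [← fwd_coe, ← fwd_coe, fwd_bwd, fwd_bwd, (tim_le _ _).tim_left, (tim_le _ _).tim_left] at h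
    apply h
    rw [← tim_tim_of_le_right _ (β.bwd_le _)]
    exact tim_le _ _
  have key : tim (α * β).tgt y =
      (α * β).fwd (α.bwd (tim α.tgt (β.bwd (tim (α * β).tgt y)))) := by
    have h0 : PLe (tim (α * β).tgt y) (β.fwd α.tgt) := tim_le _ _
    have h1 : PLe (tim (α * β).tgt y) β.tgt := h0.trans (β.fwd_le _)
    have h2 : PLe (β.bwd (tim (α * β).tgt y)) (sta α.tgt β.src) := by
      have h := (β.iso_le_iff ⟨_, β.bwd_le (tim (α * β).tgt y)⟩
        ⟨_, sta_le α.tgt β.src⟩).1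
      rw [← fwd_coe, ← fwd_coe, fwd_bwd, h1.tim_left] at h
      apply h
      rw [fwd_sta_src]
      exact h0
    rw [fwd_mul, fwd_bwd, (tim_le _ _).tim_left]
    -- The round trip through `gam` and its inverse fixes `β.bwd` of the cut-down `y`, which `h2`
    -- places below `q ⋆ s`.
    have h3 := (fRel_tim_sta α.tgt β.src).right_inv h2
    rw [tim_tim_of_le_right _ (h2.trans (sta_le _ _)), sta_sta_of_le_left _ (tim_le _ _)] at h3
    rw [← fwd_sta_src, h3, fwd_bwd, h1.tim_left]
  rw [← bwd_tim_tgt, key, bwd_fwd, hw.sta_right, bwd_tim_tgt, tgt_mul,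
    bwd_tim_of_le _ _ (β.fwd_le _), bwd_fwd]
  -- The leftover factor `q ⋆ s` comes from cutting `y` down; `P3b` turns it into `s`, which fixes
  -- everything in the range of `β.bwd`.
  rw [← bwd_tim_tgt, StrongProjAlg.P3b, (β.bwd_le y).tim_left, bwd_tim_tgt]

theorem plus_eq_plus {α β : MP P} (h : α.src = β.src) : plus α = plus β := congrArg idD h

theorem ast_eq_ast {α β : MP P} (h : α.tgt = β.tgt) : ast α = ast β := congrArg idD h

/-- Each axiom is compared on source, target and `fwd`. Axioms equating two values of ⁺ or of * need
only one equality in `P`, as identity maps are determined by their tops. -/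
instance : IsDRCRestriction (MP P) where
  assoc α β γ := ext_of_fwd (by simp only [src_mul, bwd_mul]) (by simp only [tgt_mul, fwd_mul])
    (fun x => by simp only [fwd_mul])
  plus_mul α := ext_of_fwd (by rw [src_mul, bwd_plus, StrongProjAlg.L1])
    (by rw [tgt_mul, tgt_plus, fwd_src]) (fun x => by rw [fwd_mul, fwd_plus, fwd_sta_src])
  mul_ast α := ext_of_fwd (by rw [src_mul, src_ast, bwd_tgt])
    (by rw [tgt_mul, fwd_ast, StrongProjAlg.R1])
    (fun x => by rw [fwd_mul, fwd_ast, (α.fwd_le x).sta_right])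
  plus_mul_plus α β := plus_eq_plus (by simp only [src_mul, src_plus])
  ast_ast_mul α β := ast_eq_ast (by simp only [tgt_mul, tgt_ast])
  plus_sandwich α β := by
    have h : PLe (α * β).src α.src := α.bwd_le _
    refine ext_of_fwd ?_ ?_ (fun x => ?_)
    · rw [src_mul (_ * _), bwd_mul, bwd_plus, bwd_plus, src_plus, src_plus, h.tim_right,
        h.tim_left]
    · rw [tgt_mul, tgt_mul, fwd_plus, fwd_plus, tgt_plus, tgt_plus, h.sta_left, h.sta_right]
    · rw [fwd_mul, fwd_mul, fwd_plus, fwd_plus, fwd_plus, fwd_plus, sta_sta_of_le x h,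
        ((sta_le _ _).trans h).sta_right]
  ast_sandwich α β := by
    have h : PLe (α * β).tgt β.tgt := β.fwd_le _
    refine ext_of_fwd ?_ ?_ (fun x => ?_)
    · rw [src_mul (_ * _), bwd_mul, bwd_ast, bwd_ast, src_ast, src_ast, h.tim_right,
        h.tim_left]
    · rw [tgt_mul (_ * _), tgt_mul (ast _), fwd_ast, fwd_ast, tgt_ast, tgt_ast, h.sta_left,
        h.sta_right]
    · rw [fwd_mul, fwd_mul, fwd_ast, fwd_ast, fwd_ast, fwd_ast, sta_sta_of_le x h,
        ((sta_le _ _).trans h).sta_right]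
  plus_plus _ := rfl
  ast_ast _ := rfl
  ast_plus _ := rfl
  plus_ast _ := rfl
  ample_left α β := by
    refine ext_of_fwd ?_ ?_ (fun x => ?_)
    · rw [src_mul, src_mul, src_ast, tgt_mul, bwd_fwd, bwd_ast, tgt_mul, fwd_plus,
        (sta_le _ _).tim_right]
    · rw [tgt_mul, tgt_mul, fwd_ast, tgt_ast, tgt_mul, tgt_mul, fwd_plus,
        (α.fwd_le _).sta_left, fwd_sta_src]
    · rw [fwd_mul, fwd_mul, fwd_ast, fwd_ast, tgt_mul, tgt_mul, fwd_plus,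
        fwd_sta_of_le _ _ (sta_le _ _), fwd_sta_src]
  ample_right α β := by
    refine ext_of_fwd ?_ ?_ (fun x => ?_)
    · rw [src_mul, src_mul, bwd_plus, src_plus, src_mul, src_mul, bwd_ast, bwd_tim_tgt,
        (α.bwd_le _).tim_right]
    · rw [tgt_mul, tgt_mul, fwd_plus, tgt_plus, src_mul, src_mul, bwd_ast, fwd_bwd,
        (tim_le _ _).sta_left]
    · rw [fwd_mul, fwd_mul, fwd_plus, fwd_plus, src_mul, src_mul, bwd_ast,
        fwd_sta_of_le _ _ (α.bwd_le _), fwd_bwd]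

end MP

end StrongProjAlg

/-! ### The representation of a DRC-restriction semigroup by the maps ν_a. -/

section Representation

variable {S : Type*} [BiUnary S] [IsDRCRestriction S]

theorem Proj.pLe_iff {e f : Proj S} : PLe e f ↔ f.1 * e.1 = e.1 ∧ e.1 * f.1 = e.1 := by
  have h0 : PLe e f ↔ e.1 = plus (f.1 * e.1) := Subtype.ext_iff
  rw [h0]
  constructor
  · intro h
    rw [h]
    exact ⟨f.mul_plus _, f.plus_mul_self _⟩
  · rintro ⟨h, -⟩
    rw [h, e.plus_eq]

theorem plus_mul_of_le {a : S} {e : Proj S} (h : PLe e (plusP a)) : plus (e.1 * a) = e.1 := by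
  have h1 : e.1 * plus a = e.1 := (Proj.pLe_iff.1 h).2
  rw [IsDRC.plus_mul_plus, h1, e.plus_eq]

theorem ast_mul_of_le {a : S} {e : Proj S} (h : PLe e (astP a)) : ast (a * e.1) = e.1 := by
  have h1 : ast a * e.1 = e.1 := (Proj.pLe_iff.1 h).1
  rw [IsDRC.ast_ast_mul, h1, e.ast_eq]

theorem astP_mul_le (x a : S) : PLe (astP (x * a)) (astP a) := by
  have h : ast (x * a) = ast a * ast (x * a) * ast a := IsDRC.ast_sandwich x a
  have h0 : ast a * ast a = ast a := (astP a).mul_self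
  refine Proj.pLe_iff.2 ⟨?_, ?_⟩
  · change ast a * ast (x * a) = ast (x * a)
    rw [h, ← IsDRC.assoc, ← IsDRC.assoc, h0]
  · change ast (x * a) * ast a = ast (x * a)
    rw [h, IsDRC.assoc, h0]

theorem plusP_mul_le (a y : S) : PLe (plusP (a * y)) (plusP a) := by
  have h : plus (a * y) = plus a * plus (a * y) * plus a := IsDRC.plus_sandwich a y
  have h0 : plus a * plus a = plus a := (plusP a).mul_self
  refine Proj.pLe_iff.2 ⟨?_, ?_⟩
  · change plus a * plus (a * y) = plus (a * y)
    rw [h, ← IsDRC.assoc, ← IsDRC.assoc, h0]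
  · change plus (a * y) * plus a = plus (a * y)
    rw [h, IsDRC.assoc, h0]

/-- The left ample condition, whose right side collapses because `e * plus a = e`. It makes `y ↦
(ay)⁺` undo `x ↦ (xa)*`. -/
theorem mul_ast_mul_of_le {a : S} {e : Proj S} (h : PLe e (plusP a)) :
    a * ast (e.1 * a) = e.1 * a := by
  have h1 : e.1 * plus a = e.1 := (Proj.pLe_iff.1 h).2
  rw [IsDRCRestriction.ample_left, h1, e.ast_eq]

theorem plus_mul_mul_of_le {a : S} {e : Proj S} (h : PLe e (astP a)) :
    plus (a * e.1) * a = a * e.1 := by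
  have h1 : ast a * e.1 = e.1 := (Proj.pLe_iff.1 h).1
  rw [IsDRCRestriction.ample_right, h1, e.plus_eq]

/-- Two projections pass across `a` in turn. Applying ⁺ or * to this identity shows that ν_a
preserves × or ⋆. -/
theorem mul_mul_eq_mul_ast_mul_ast {a : S} {e f : Proj S} (he : PLe e (plusP a))
    (hf : PLe f (plusP a)) :
    e.1 * f.1 * a = a * (ast (e.1 * a) * ast (f.1 * a)) := by
  rw [← IsDRC.assoc, mul_ast_mul_of_le he, IsDRC.assoc, IsDRC.assoc, mul_ast_mul_of_le hf]

/-- The isomorphism `ν_a : (a⁺)↓ → (a*)↓`, `x ↦ (xa)*`; its inverse is `y ↦ (ay)⁺`. -/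
def nu (a : S) : MP (Proj S) where
  src := plusP a
  tgt := astP a
  iso :=
    { toFun := fun x => ⟨astP (x.1.1 * a), astP_mul_le _ _⟩
      invFun := fun y => ⟨plusP (a * y.1.1), plusP_mul_le _ _⟩
      left_inv := fun x => Subtype.ext <| Subtype.ext <| by
        change plus (a * ast (x.1.1 * a)) = x.1.1
        rw [mul_ast_mul_of_le x.2, plus_mul_of_le x.2]
      right_inv := fun y => Subtype.ext <| Subtype.ext <| by
        change ast (plus (a * y.1.1) * a) = y.1.1
        rw [plus_mul_mul_of_le y.2, ast_mul_of_le y.2] }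
  map_tim x y := Subtype.ext <| Subtype.ext <| by
    change ast (plus (x.1.1 * y.1.1) * a) = plus (ast (x.1.1 * a) * ast (y.1.1 * a))
    have hle : PLe (plusP (ast (x.1.1 * a) * ast (y.1.1 * a))) (astP a) :=
      (tim_le (astP (x.1.1 * a)) (astP (y.1.1 * a))).trans (astP_mul_le _ _)
    have h1 : y.1.1 * plus a = y.1.1 := (Proj.pLe_iff.1 y.2).2
    -- With g = xν_a × yν_a, this says x × y = (ag)⁺, the preimage of g; `h3` and `h4` map it back
    -- to g.
    have h2 : plus (x.1.1 * y.1.1) = plus (a * plus (ast (x.1.1 * a) * ast (y.1.1 * a))) := by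
      rw [← IsDRC.plus_mul_plus a, ← mul_mul_eq_mul_ast_mul_ast x.2 y.2,
        IsDRC.plus_mul_plus _ a, IsDRC.assoc, h1]
    have h3 := plus_mul_mul_of_le hle
    have h4 := ast_mul_of_le hle
    rw [h2]
    exact (congrArg ast h3).trans h4
  map_sta x y := Subtype.ext <| Subtype.ext <| by
    change ast (ast (x.1.1 * y.1.1) * a) = ast (ast (x.1.1 * a) * ast (y.1.1 * a))
    have h1 : ast a * ast (x.1.1 * a) = ast (x.1.1 * a) :=
      (Proj.pLe_iff.1 (astP_mul_le x.1.1 a)).1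
    rw [← IsDRC.ast_ast_mul, mul_mul_eq_mul_ast_mul_ast x.2 y.2, IsDRC.ast_ast_mul a,
      ← IsDRC.assoc, h1]

theorem fwd_nu (a : S) (x : Proj S) : (nu a).fwd x = astP (x.1 * a) := by
  apply Subtype.ext
  change ast (ast (x.1 * plus a) * a) = ast (x.1 * a)
  rw [← IsDRC.ast_ast_mul, IsDRC.assoc, IsDRC.plus_mul]

theorem bwd_nu (a : S) (y : Proj S) : (nu a).bwd y = plusP (a * y.1) := by
  apply Subtype.ext
  change plus (a * plus (ast a * y.1)) = plus (a * y.1)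
  rw [← IsDRC.plus_mul_plus, ← IsDRC.assoc, IsDRC.mul_ast]

theorem nu_mul (a b : S) : nu (a * b) = nu a * nu b := by
  refine MP.ext_of_fwd ?_ ?_ (fun x => ?_)
  · rw [MP.src_mul, bwd_nu]
    exact Subtype.ext (IsDRC.plus_mul_plus a b)
  · rw [MP.tgt_mul, fwd_nu]
    exact Subtype.ext (IsDRC.ast_ast_mul a b)
  · rw [MP.fwd_mul, fwd_nu, fwd_nu, fwd_nu]
    apply Subtype.ext
    change ast (x.1 * (a * b)) = ast (ast (x.1 * a) * b)
    rw [← IsDRC.ast_ast_mul, IsDRC.assoc]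

theorem nu_proj (p : Proj S) : nu p.1 = MP.idD p := by
  refine MP.ext_of_fwd (Subtype.ext p.plus_eq) (Subtype.ext p.ast_eq) (fun x => ?_)
  rw [fwd_nu]
  rfl

theorem isHom_nu : IsHom (nu : S → MP (Proj S)) where
  map_mul := nu_mul
  map_plus a := nu_proj (plusP a)
  map_ast a := nu_proj (astP a)

/-- The clauses of μ_S are read off as source, target, `bwd` and `fwd` of ν_a evaluated at
projections. -/
theorem nu_eq_nu_iff (a b : S) : nu a = nu b ↔ (mu S).r a b := by
  constructor
  · intro h
    refine ⟨congrArg (fun α => α.src.1) h, congrArg (fun α => α.tgt.1) h, fun p hp => ⟨?_, ?_⟩⟩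
    · have h1 := congrArg (fun α => (α.bwd ⟨p, hp⟩).1) h
      simp only [bwd_nu] at h1
      exact h1
    · have h1 := congrArg (fun α => (α.fwd ⟨p, hp⟩).1) h
      simp only [fwd_nu] at h1
      exact h1
  · rintro ⟨h1, h2, h3⟩
    refine MP.ext_of_fwd (Subtype.ext h1) (Subtype.ext h2) (fun x => ?_)
    rw [fwd_nu, fwd_nu]
    exact Subtype.ext (h3 x.1 x.2).2

end Representation

/-! ### Projection-separating congruences, homomorphic images and fundamentality. -/

section Congruences

theorem mu_projectionSeparating (S : Type*) [BiUnary S] [IsDRC S] :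
    (mu S).ProjectionSeparating := by
  intro p q hp hq h
  have h1 : plus p = plus q := h.1
  rwa [Proj.plus_eq ⟨p, hp⟩, Proj.plus_eq ⟨q, hq⟩] at h1

/-- Values of ⁺ (or of *) at related elements are related projections, hence equal; this is applied
to a, b and to their products with p. -/
theorem Congruence.ProjectionSeparating.le_mu {S : Type*} [BiUnary S] [IsDRC S]
    {σ : Congruence S} (hσ : σ.ProjectionSeparating) {a b : S} (h : σ.r a b) :
    (mu S).r a b := by
  have hp : ∀ {c d : S}, σ.r c d → plus c = plus d := fun k =>
    hσ _ _ ⟨_, rfl⟩ ⟨_, rfl⟩ (σ.plus_congr k)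
  have ha : ∀ {c d : S}, σ.r c d → ast c = ast d := fun k =>
    hσ _ _ ⟨_, (IsDRC.plus_ast _).symm⟩ ⟨_, (IsDRC.plus_ast _).symm⟩ (σ.ast_congr k)
  exact ⟨hp h, ha h, fun p _ => ⟨hp (σ.mul_right p h), ha (σ.mul_left p h)⟩⟩

/-- The inverse image of a congruence under a homomorphism. -/
def Congruence.comap {S T : Type*} [BiUnary S] [BiUnary T] (σ : Congruence T) {φ : S → T}
    (hφ : IsHom φ) : Congruence S where
  r a b := σ.r (φ a) (φ b)
  iseqv := ⟨fun _ => σ.iseqv.refl _, fun h => σ.iseqv.symm h, fun h k => σ.iseqv.trans h k⟩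
  mul_right c h := by
    rw [hφ.map_mul, hφ.map_mul]
    exact σ.mul_right _ h
  mul_left c h := by
    rw [hφ.map_mul, hφ.map_mul]
    exact σ.mul_left _ h
  plus_congr h := by
    rw [hφ.map_plus, hφ.map_plus]
    exact σ.plus_congr h
  ast_congr h := by
    rw [hφ.map_ast, hφ.map_ast]
    exact σ.ast_congr h

variable {S T : Type*} [BiUnary S] [BiUnary T]

/-- The kernel μ_S separates projections, so φ is injective on them and pulling back preserves
projection separation. Maximality of μ_S then puts the pullback inside the kernel. It serves both
the image of φ_S and the quotient by μ_S. -/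
theorem isFundamental_of_surjective [IsDRC S] {φ : S → T} (hφ : IsHom φ)
    (hs : Function.Surjective φ) (hk : ∀ a b, φ a = φ b ↔ (mu S).r a b) : IsFundamental T := by
  intro σ hσ a b h
  obtain ⟨a, rfl⟩ := hs a
  obtain ⟨b, rfl⟩ := hs b
  have hproj : ∀ p : S, IsProj p → IsProj (φ p) := by
    rintro _ ⟨x, rfl⟩
    exact ⟨φ x, hφ.map_plus x⟩
  have hsep : (σ.comap hφ).ProjectionSeparating := fun p q hp hq k =>
    mu_projectionSeparating S p q hp hq
      ((hk p q).1 (hσ _ _ (hproj p hp) (hproj q hq) k))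
  exact (hk a b).2 (hsep.le_mu h)

/-- All the axioms are identities, so they pass to homomorphic images. -/
theorem isDRCRestriction_of_surjective [IsDRCRestriction S] {φ : S → T} (hφ : IsHom φ)
    (hs : Function.Surjective φ) : IsDRCRestriction T where
  assoc := hs.forall₃.2 fun x y z => by simp only [← hφ.map_mul, IsDRC.assoc]
  plus_mul := hs.forall.2 fun x => by simp only [← hφ.map_mul, ← hφ.map_plus, IsDRC.plus_mul]
  mul_ast := hs.forall.2 fun x => by simp only [← hφ.map_mul, ← hφ.map_ast, IsDRC.mul_ast]
  plus_mul_plus := hs.forall₂.2 fun x y => by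
    simp only [← hφ.map_mul, ← hφ.map_plus]; rw [IsDRC.plus_mul_plus]
  ast_ast_mul := hs.forall₂.2 fun x y => by
    simp only [← hφ.map_mul, ← hφ.map_ast]; rw [IsDRC.ast_ast_mul]
  plus_sandwich := hs.forall₂.2 fun x y => by
    simp only [← hφ.map_mul, ← hφ.map_plus]; rw [← IsDRC.plus_sandwich]
  ast_sandwich := hs.forall₂.2 fun x y => by
    simp only [← hφ.map_mul, ← hφ.map_ast]; rw [← IsDRC.ast_sandwich]
  plus_plus := hs.forall.2 fun x => by simp only [← hφ.map_plus, IsDRC.plus_plus]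
  ast_ast := hs.forall.2 fun x => by simp only [← hφ.map_ast, IsDRC.ast_ast]
  ast_plus := hs.forall.2 fun x => by simp only [← hφ.map_ast, ← hφ.map_plus, IsDRC.ast_plus]
  plus_ast := hs.forall.2 fun x => by simp only [← hφ.map_ast, ← hφ.map_plus, IsDRC.plus_ast]
  ample_left := hs.forall₂.2 fun x y => by
    simp only [← hφ.map_mul, ← hφ.map_ast, ← hφ.map_plus]; rw [IsDRCRestriction.ample_left]
  ample_right := hs.forall₂.2 fun x y => by
    simp only [← hφ.map_mul, ← hφ.map_ast, ← hφ.map_plus]; rw [IsDRCRestriction.ample_right]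

/-- The image of a homomorphism. -/
def IsHom.range {φ : S → T} (hφ : IsHom φ) : Subalg T where
  carrier := Set.range φ
  mul_mem := by
    rintro _ _ ⟨a, rfl⟩ ⟨b, rfl⟩
    exact ⟨a * b, hφ.map_mul a b⟩
  plus_mem := by
    rintro _ ⟨a, rfl⟩
    exact ⟨plus a, hφ.map_plus a⟩
  ast_mem := by
    rintro _ ⟨a, rfl⟩
    exact ⟨ast a, hφ.map_ast a⟩

theorem IsHom.rangeFactorization {φ : S → T} (hφ : IsHom φ) :
    IsHom (fun a => (⟨φ a, a, rfl⟩ : hφ.range.carrier)) where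
  map_mul a b := Subtype.ext (hφ.map_mul a b)
  map_plus a := Subtype.ext (hφ.map_plus a)
  map_ast a := Subtype.ext (hφ.map_ast a)

theorem Congruence.isHom_proj (σ : Congruence S) : IsHom σ.proj where
  map_mul _ _ := rfl
  map_plus _ := rfl
  map_ast _ := rfl

theorem Congruence.proj_surjective (σ : Congruence S) : Function.Surjective σ.proj :=
  Quotient.mk_surjective

theorem Congruence.proj_eq_proj_iff (σ : Congruence S) (a b : S) :
    σ.proj a = σ.proj b ↔ σ.r a b :=
  Quotient.eq (r := σ.toSetoid)

theorem IsHom.exists_quot_equiv_range {φ : S → T} (hφ : IsHom φ) (σ : Congruence S)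
    (hk : ∀ a b, φ a = φ b ↔ σ.r a b) :
    ∃ e : σ.Quot ≃ hφ.range.carrier, IsHom e ∧ ∀ a : S, (e (σ.proj a)).1 = φ a := by
  let f : σ.Quot → hφ.range.carrier :=
    Quotient.lift (fun a => (⟨φ a, a, rfl⟩ : hφ.range.carrier))
      (fun a b h => Subtype.ext ((hk a b).2 h))
  have hf : ∀ a, f (σ.proj a) = ⟨φ a, a, rfl⟩ := fun _ => rfl
  have hbij : Function.Bijective f := by
    constructor
    · refine σ.proj_surjective.forall₂.2 fun a b h => ?_
      rw [hf, hf] at h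
      exact (σ.proj_eq_proj_iff a b).2 ((hk a b).1 (congrArg Subtype.val h))
    · rintro ⟨_, a, rfl⟩
      exact ⟨σ.proj a, hf a⟩
  refine ⟨Equiv.ofBijective f hbij, ⟨?_, ?_, ?_⟩, fun a => rfl⟩
  · exact σ.proj_surjective.forall₂.2 fun a b => hφ.rangeFactorization.map_mul a b
  · exact σ.proj_surjective.forall.2 fun a => hφ.rangeFactorization.map_plus a
  · exact σ.proj_surjective.forall.2 fun a => hφ.rangeFactorization.map_ast a

end Congruences

end DRC

theorem theorem8p8 {S : Type*} [DRC.BiUnary S] [DRC.IsDRCRestriction S] :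
    -- `S(M(P(S)))` is a DRC-restriction semigroup
    DRC.IsDRCRestriction (DRC.MP (DRC.Proj S)) ∧
    -- `μ_S` is the maximum projection-separating (2,1,1)-congruence on `S`
    (DRC.mu S).ProjectionSeparating ∧
    (∀ σ : DRC.Congruence S, σ.ProjectionSeparating → ∀ a b : S, σ.r a b → (DRC.mu S).r a b) ∧
    ∃ φ : S → DRC.MP (DRC.Proj S),
      -- `φ a` is the map `ν_a : (a⁺)↓ → (a*)↓`, `x ↦ (xa)*`
      (∀ a : S, (φ a).src.1 = DRC.BiUnary.plus a ∧ (φ a).tgt.1 = DRC.BiUnary.ast a ∧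
        (∀ x : DRC.Proj S, x ∈ DRC.down (φ a).src ↔ DRC.NatLe x.1 (DRC.BiUnary.plus a)) ∧
        (∀ x : DRC.Proj S, x ∈ DRC.down (φ a).tgt ↔ DRC.NatLe x.1 (DRC.BiUnary.ast a)) ∧
        ∀ x : DRC.down (φ a).src, ((φ a).iso x).1.1 = DRC.BiUnary.ast (x.1.1 * a)) ∧
      DRC.IsHom φ ∧
      (∀ a b : S, φ a = φ b ↔ (DRC.mu S).r a b) ∧
      (∀ p : DRC.Proj S, φ p.1 = DRC.MP.idD p) ∧
      (DRC.IsFundamental S ↔ Function.Injective φ) ∧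
      -- the image of `φ` is a (2,1,1)-subalgebra, isomorphic to `S/μ_S` and fundamental
      ∃ T : DRC.Subalg (DRC.MP (DRC.Proj S)),
        T.carrier = Set.range φ ∧
        DRC.IsDRCRestriction T.carrier ∧
        DRC.IsDRCRestriction (DRC.mu S).Quot ∧
        (∃ e : (DRC.mu S).Quot ≃ T.carrier, DRC.IsHom e ∧
          ∀ a : S, (e ((DRC.mu S).proj a)).1 = φ a) ∧
        DRC.IsFundamental T.carrier ∧
        DRC.IsFundamental (DRC.mu S).Quot := by 
  have hφ := DRC.isHom_nu (S := S)
  have hk := DRC.nu_eq_nu_iff (S := S)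
  have hs : Function.Surjective
      (fun a => (⟨DRC.nu a, a, rfl⟩ : (DRC.IsHom.range hφ).carrier)) := by
    rintro ⟨_, a, rfl⟩
    exact ⟨a, rfl⟩
  refine ⟨inferInstance, DRC.mu_projectionSeparating S, fun σ hσ a b h => hσ.le_mu h, DRC.nu,
    fun a => ⟨rfl, rfl, fun x => (DRC.natLe_iff x (DRC.plusP a)).symm,
      fun x => (DRC.natLe_iff x (DRC.astP a)).symm, fun x => rfl⟩,
    hφ, hk, DRC.nu_proj, ⟨?_, ?_⟩, hφ.range, rfl,
    DRC.isDRCRestriction_of_surjective hφ.rangeFactorization hs,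
    DRC.isDRCRestriction_of_surjective (DRC.mu S).isHom_proj (DRC.mu S).proj_surjective,
    hφ.exists_quot_equiv_range (DRC.mu S) hk,
    DRC.isFundamental_of_surjective hφ.rangeFactorization hs
      fun a b => Subtype.ext_iff.trans (hk a b),
    DRC.isFundamental_of_surjective (DRC.mu S).isHom_proj (DRC.mu S).proj_surjective
      (DRC.mu S).proj_eq_proj_iff⟩
  -- Fundamentality is tested on μ_S itself, the kernel of φ_S.
  · exact fun h a b hab => h _ (DRC.mu_projectionSeparating S) a b ((hk a b).1 hab)
  · exact fun h σ hσ a b hab => h ((hk a b).2 (hσ.le_mu hab))
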